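/- Let $d\ge 1$ and let $\mathbb S^{d-1}=\{x\in\mathbb R^d:|x|=1\}$ be the Euclidean unit sphere. Let $X=(X_1,\dots,X_d)$ be an $\mathbb S^{d-1}$-valued random vector such that the family $\{X_1,\dots,X_d\}$ is exchangeable, i.e. for every permutation $\sigma$ of $\{1,\dots,d\}$ the vectors $(X_{\sigma(1)},\dots,X_{\sigma(d)})$ and $(X_1,\dots,X_d)$ have the same law. Let $H$ be an infinite subgroup of $SO(d)$ that acts irreducibly on $\mathbb R^d$ (the only $H$-invariant linear subspaces of $\mathbb R^d$ are $\{0\}$ and $\mathbb R^d$), and suppose that the law of $X$ is invariant under $H$, i.e. $gX$ has the same law as $X$ for every $g\in H$. Then the law of $X$ is the normalized Lebesgue (uniform) measure on $\mathbb S^{d-1}$. -/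

import Mathlib

open MeasureTheory ProbabilityTheory

/-- The finite family `Y 0, …, Y (d - 1)` of real random variables is exchangeable: for every
permutation `σ`, the vectors `(Y (σ 0), …, Y (σ (d - 1)))` and `(Y 0, …, Y (d - 1))` have the
same law. -/
def IsExchangeable {Ω : Type*} [MeasurableSpace Ω] {d : ℕ} (Y : Fin d → Ω → ℝ)
    (P : Measure Ω) : Prop :=
  ∀ σ : Equiv.Perm (Fin d),
    IdentDistrib (fun ω i => Y (σ i) ω) (fun ω i => Y i ω) P P

/-- The standard representation `g ↦ (x ↦ g x)` on `ℝ^d` of a subgroup of `SO(d)`. -/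
noncomputable def standardRep {d : ℕ}
    (H : Subgroup (Matrix.specialOrthogonalGroup (Fin d) ℝ)) :
    Representation ℝ H (EuclideanSpace ℝ (Fin d)) where
  toFun g := Matrix.toEuclideanLin ((g : Matrix.specialOrthogonalGroup (Fin d) ℝ) :
    Matrix (Fin d) (Fin d) ℝ)
  map_one' := Matrix.toLpLin_one 2
  map_mul' _ _ := Matrix.toLpLin_mul 2 2 2 _ _

/-- The measure `μ` on `ℝ^d` is invariant under the subgroup `H` of `SO(d)`. -/
def IsInvariantUnder {d : ℕ} (H : Subgroup (Matrix.specialOrthogonalGroup (Fin d) ℝ))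
    (μ : Measure (EuclideanSpace ℝ (Fin d))) : Prop :=
  ∀ g : H, μ.map (standardRep H g) = μ

/-- The normalized Lebesgue measure on the unit sphere `S^{d-1}` of `ℝ^d`: the surface measure
divided by its total mass. -/
noncomputable def uniformSphere (d : ℕ) :
    Measure (Metric.sphere (0 : EuclideanSpace ℝ (Fin d)) 1) :=
  ((volume : Measure (EuclideanSpace ℝ (Fin d))).toSphere Set.univ)⁻¹ •
    (volume : Measure (EuclideanSpace ℝ (Fin d))).toSphere

/-!
The law `μ` of `X` is determined by its characteristic function `φ`, which is smooth because `μ` has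
bounded support, and `φ` inherits every linear isometric symmetry of `μ`: it is invariant under
`H` and under permutations of the coordinates. It suffices to show that `φ` is radial. Indeed, two
probability measures on the unit sphere with radial characteristic functions agree
(`ext_of_radial_charFun`), and reflections show that the uniform measure has a radial one.

To see that `φ` is radial, consider the space `𝔤` of skew-symmetric matrices `A` with
`Dφ(x)(A x) = 0` for all `x` (`infinitesimalSymmetries`). Working with this space, rather than with
the Lie algebra of the closed group of symmetries of `φ`, makes it evident that `𝔤` is a linear
subspace, and no matrix exponential is needed. It has the following properties.

* It is a Lie algebra, since second derivatives are symmetric, and it is stable under conjugation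
  by the symmetries of `φ`.
* It is nonzero: as `H` is infinite and bounded, its elements accumulate at the identity, and a
  limit point of the directions `(U - 1) / ‖U - 1‖` lies in `𝔤`
  (`exists_ne_zero_mem_infinitesimalSymmetries`).
* Some `A ∈ 𝔤` does not kill the all-ones vector `1`, because the common kernel of `𝔤` is an
  `H`-invariant proper subspace, hence is zero by irreducibility.

Averaging this `A` over the permutations fixing a suitable index `i` gives a nonzero multiple of
`e i ∧ 1`. By symmetry `𝔤` contains every `e j ∧ 1`; the brackets of these produce every
`e j ∧ e k`, so `𝔤` consists of all skew-symmetric matrices (`mem_of_transpose_eq_neg`). The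
derivative of `φ` then vanishes in all directions tangent to spheres. Finally `𝔤 ≠ 0` forces
`d ≥ 2`, so that the spheres are connected and `φ` is constant on each of them.
-/

section

open Filter
open scoped Matrix RealInnerProductSpace Topology

variable {n : Type*} [Fintype n] [DecidableEq n]

/-! ### Lie algebras of skew-symmetric matrices -/

/-- The matrix of `x ∧ y`, that is, `v ↦ ⟪y, v⟫ x - ⟪x, v⟫ y`. -/
def wedge {n : Type*} (x y : n → ℝ) : Matrix n n ℝ :=
  Matrix.vecMulVec x y - Matrix.vecMulVec y x

theorem wedge_apply {n : Type*} (x y : n → ℝ) (i j : n) :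
    wedge x y i j = x i * y j - y i * x j := by
  simp [wedge, Matrix.vecMulVec_apply]

theorem wedge_mulVec {n : Type*} [Fintype n] (x y v : n → ℝ) :
    wedge x y *ᵥ v = (y ⬝ᵥ v) • x - (x ⬝ᵥ v) • y := by
  ext i
  simp [wedge, Matrix.sub_mulVec, Matrix.vecMulVec_mulVec]

theorem transpose_wedge {n : Type*} (x y : n → ℝ) : (wedge x y)ᵀ = -wedge x y := by
  ext i j
  simp only [Matrix.transpose_apply, Matrix.neg_apply, wedge_apply]
  ring

/-- The Lie bracket `[x ∧ z, y ∧ z]`. For `⟪z, z⟫ ≠ 0` the identity recovers `x ∧ y` from `x ∧ z`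
and `y ∧ z`. -/
theorem wedge_mul_wedge_sub {n : Type*} [Fintype n] (x y z : n → ℝ) :
    wedge x z * wedge y z - wedge y z * wedge x z =
      (z ⬝ᵥ y) • wedge x z - (z ⬝ᵥ x) • wedge y z - (z ⬝ᵥ z) • wedge x y := by
  ext i j
  simp only [wedge, sub_mul, mul_sub, Matrix.vecMulVec_mul_vecMulVec, Matrix.sub_apply,
    Matrix.smul_apply, smul_eq_mul, Matrix.vecMulVec_apply, Pi.smul_apply, dotProduct_comm y x,
    dotProduct_comm y z, dotProduct_comm x z]
  ring

theorem sum_smul_wedge_single {A : Matrix n n ℝ} (hA : Aᵀ = -A) :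
    ∑ i, ∑ j, A i j • wedge (Pi.single i 1) (Pi.single j 1) = (2 : ℝ) • A := by
  have h (k l : n) : A k l = -A l k := by simpa using congrFun₂ hA l k
  ext k l
  simp only [Matrix.sum_apply, Matrix.smul_apply, smul_eq_mul, wedge_apply, mul_sub,
    Finset.sum_sub_distrib]
  have hsum (a b : n) : ∑ i, ∑ j, A i j * ((Pi.single i 1 : n → ℝ) a * (Pi.single j 1 : n → ℝ) b) =
      A a b := by
    rw [Finset.sum_eq_single a (fun i _ hi => by simp [Pi.single_apply, hi.symm]) (by simp),
      Finset.sum_eq_single b (fun j _ hj => by simp [hj.symm]) (by simp)]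
    simp
  rw [hsum k l, Finset.sum_congr rfl fun i _ => Finset.sum_congr rfl fun j _ => by
    rw [mul_comm ((Pi.single j 1 : n → ℝ) k)], hsum l k]
  linarith [h k l]

/-- The sum of the conjugates of a skew-symmetric matrix `A` under the permutations fixing `i` is
invariant under these. Its entries off row and column `i` are therefore both symmetric and
antisymmetric, hence zero, and its entries in row `i` off the diagonal are all equal; their sum is a
positive multiple of the `i`-th row sum of `A`. -/
theorem exists_sum_submatrix_stabilizer_eq_smul_wedge {A : Matrix n n ℝ} (hA : Aᵀ = -A) (i : n)
    (hi : (A *ᵥ 1) i ≠ 0) :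
    ∃ c : ℝ, c ≠ 0 ∧ ∑ σ : Equiv.Perm n with σ i = i, A.submatrix σ σ =
      c • wedge (Pi.single i 1) 1 := by
  set s : Finset (Equiv.Perm n) := {σ | σ i = i} with hs
  set M : Matrix n n ℝ := ∑ σ ∈ s, A.submatrix σ σ with hM
  have hskew (j k : n) : M j k = -M k j := by
    have h (k l : n) : A k l = -A l k := by simpa using congrFun₂ hA l k
    simp only [hM, Matrix.sum_apply, Matrix.submatrix_apply, ← Finset.sum_neg_distrib]
    exact Finset.sum_congr rfl fun σ _ => h _ _
  have hinv (τ : Equiv.Perm n) (hτ : τ i = i) (j k : n) : M (τ j) (τ k) = M j k := by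
    simp only [hM, Matrix.sum_apply, Matrix.submatrix_apply]
    refine Finset.sum_equiv (Equiv.mulRight τ) (fun σ => ?_) fun σ _ => by simp
    simp [hs, hτ]
  have h0 (j k : n) (hj : j ≠ i) (hk : k ≠ i) : M j k = 0 := by
    have h1 := hinv (Equiv.swap j k) (Equiv.swap_apply_of_ne_of_ne hj.symm hk.symm) j k
    rw [Equiv.swap_apply_left, Equiv.swap_apply_right] at h1
    linarith [hskew j k]
  have hii : M i i = 0 := by linarith [hskew i i]
  have hconst (j k : n) (hj : j ≠ i) (hk : k ≠ i) : M i j = M i k := by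
    have h1 := hinv (Equiv.swap j k) (Equiv.swap_apply_of_ne_of_ne hj.symm hk.symm) i j
    rw [Equiv.swap_apply_left, Equiv.swap_apply_of_ne_of_ne hj.symm hk.symm] at h1
    exact h1.symm
  have hrow : ∑ j, M i j ≠ 0 := by
    have h1 : ∑ j, M i j = s.card * (A *ᵥ 1) i := by
      simp only [hM, Matrix.sum_apply, Matrix.submatrix_apply]
      rw [Finset.sum_comm, ← nsmul_eq_mul]
      refine Finset.sum_eq_card_nsmul fun σ hσ => ?_
      have hσ' : σ i = i := by simpa [hs] using hσ
      rw [hσ', Equiv.sum_comp σ (fun j => A i j)]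
      simp [Matrix.mulVec, dotProduct]
    rw [h1]
    refine mul_ne_zero (Nat.cast_ne_zero.2 (Finset.card_ne_zero_of_mem (a := 1) ?_)) hi
    simp [hs]
  obtain ⟨j, -, hj⟩ := Finset.exists_ne_zero_of_sum_ne_zero hrow
  have hji : j ≠ i := by rintro rfl; exact hj hii
  refine ⟨M i j, hj, ?_⟩
  ext k l
  simp only [Matrix.smul_apply, wedge_apply, smul_eq_mul, Pi.single_apply, Pi.one_apply]
  by_cases hk : k = i <;> by_cases hl : l = i
  · subst hk; subst hl; simp [hii]
  · subst hk; simp [hl, hconst l j hl hji]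
  · subst hl; simp [hk, hskew k l, hconst k j hk hji]
  · simp [hk, hl, h0]

/-- A Lie algebra of skew-symmetric matrices that is stable under permutation of the coordinates and
does not annihilate the all-ones vector contains all skew-symmetric matrices. -/
theorem mem_of_transpose_eq_neg (g : Submodule ℝ (Matrix n n ℝ)) (hskew : ∀ A ∈ g, Aᵀ = -A)
    (hperm : ∀ A ∈ g, ∀ σ : Equiv.Perm n, A.submatrix σ σ ∈ g)
    (hlie : ∀ A ∈ g, ∀ B ∈ g, A * B - B * A ∈ g)
    (hone : ∃ A ∈ g, A *ᵥ 1 ≠ 0) {B : Matrix n n ℝ} (hB : Bᵀ = -B) : B ∈ g := by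
  obtain ⟨A, hA, hA1⟩ := hone
  obtain ⟨i, hi⟩ := Function.ne_iff.1 hA1
  have hwi : wedge (Pi.single i 1) 1 ∈ g := by
    obtain ⟨c, hc, h⟩ := exists_sum_submatrix_stabilizer_eq_smul_wedge (hskew A hA) i hi
    rw [← g.smul_mem_iff hc, ← h]
    exact g.sum_mem fun σ _ => hperm A hA σ
  have hw (j : n) : wedge (Pi.single j 1) 1 ∈ g := by
    convert hperm _ hwi (Equiv.swap i j) using 1
    ext k l
    simp [wedge_apply, Pi.single_apply, Equiv.swap_apply_eq_iff]
  have hwedge (j k : n) : wedge (Pi.single j 1) (Pi.single k 1) ∈ g := by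
    have hcard : (1 : n → ℝ) ⬝ᵥ 1 ≠ 0 := by
      have : Nonempty n := ⟨i⟩
      simp [Fintype.card_ne_zero]
    rw [← g.smul_mem_iff hcard]
    have h := wedge_mul_wedge_sub (Pi.single j 1) (Pi.single k 1) (1 : n → ℝ)
    rw [eq_sub_iff_add_eq, ← eq_sub_iff_add_eq'] at h
    rw [h]
    exact g.sub_mem (g.sub_mem (g.smul_mem _ (hw j)) (g.smul_mem _ (hw k)))
      (hlie _ (hw j) _ (hw k))
  rw [← g.smul_mem_iff (two_ne_zero (α := ℝ)), ← sum_smul_wedge_single hB]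
  exact g.sum_mem fun j _ => g.sum_mem fun k _ => g.smul_mem _ (hwedge j k)

/-! ### Infinitesimal symmetries of a function -/

theorem toEuclideanLin_mul_apply (A B : Matrix n n ℝ) (x : EuclideanSpace ℝ n) :
    (A * B).toEuclideanLin x = A.toEuclideanLin (B.toEuclideanLin x) := by
  simp [Matrix.toLpLin_apply, Matrix.mulVec_mulVec]

theorem inner_toEuclideanLin_left (A : Matrix n n ℝ) (x y : EuclideanSpace ℝ n) :
    ⟪A.toEuclideanLin x, y⟫ = ⟪x, Aᵀ.toEuclideanLin y⟫ := by
  simp only [EuclideanSpace.inner_eq_star_dotProduct, Matrix.ofLp_toLpLin, Matrix.toLin'_apply,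
    star_trivial, Matrix.dotProduct_mulVec, Matrix.mulVec_transpose, dotProduct_comm]

theorem inner_toEuclideanLin_toEuclideanLin {U : Matrix n n ℝ} (hU : Uᵀ * U = 1)
    (x y : EuclideanSpace ℝ n) : ⟪U.toEuclideanLin x, U.toEuclideanLin y⟫ = ⟪x, y⟫ := by
  rw [inner_toEuclideanLin_left, ← toEuclideanLin_mul_apply, hU]
  simp

/-- The skew-symmetric matrices whose linear vector field `x ↦ A x` annihilates `f`. -/
noncomputable def infinitesimalSymmetries (f : EuclideanSpace ℝ n → ℂ) :
    Submodule ℝ (Matrix n n ℝ) where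
  carrier := {A | Aᵀ = -A ∧ ∀ x, fderiv ℝ f x (A.toEuclideanLin x) = 0}
  add_mem' hA hB := ⟨by simp [hA.1, hB.1, add_comm], fun x => by simp [hA.2 x, hB.2 x]⟩
  zero_mem' := by simp
  smul_mem' c A hA := ⟨by simp [hA.1], fun x => by simp [hA.2 x]⟩

theorem mem_infinitesimalSymmetries {f : EuclideanSpace ℝ n → ℂ} {A : Matrix n n ℝ} :
    A ∈ infinitesimalSymmetries f ↔
      Aᵀ = -A ∧ ∀ x, fderiv ℝ f x (A.toEuclideanLin x) = 0 := Iff.rfl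

/-- Differentiating `Df(x)(A x) = 0` in the direction `B x`, differentiating `Df(x)(B x) = 0` in the
direction `A x`, and subtracting cancels the second derivatives. -/
theorem mul_sub_mul_mem_infinitesimalSymmetries {f : EuclideanSpace ℝ n → ℂ}
    (hf : ContDiff ℝ 2 f) {A B : Matrix n n ℝ} (hA : A ∈ infinitesimalSymmetries f)
    (hB : B ∈ infinitesimalSymmetries f) : A * B - B * A ∈ infinitesimalSymmetries f := by
  refine ⟨by simp [hA.1, hB.1], fun x => ?_⟩
  have hf' : Differentiable ℝ (fderiv ℝ f) :=
    (hf.fderiv_right (m := 1) (by norm_num)).differentiable (by norm_num)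
  have key {C : Matrix n n ℝ} (hC : C ∈ infinitesimalSymmetries f) (v : EuclideanSpace ℝ n) :
      fderiv ℝ (fderiv ℝ f) x v (C.toEuclideanLin x) + fderiv ℝ f x (C.toEuclideanLin v) = 0 := by
    have h := (hf' x).hasFDerivAt.clm_apply
      (LinearMap.toContinuousLinearMap C.toEuclideanLin).hasFDerivAt
    have h0 : (fun y => fderiv ℝ f y (LinearMap.toContinuousLinearMap C.toEuclideanLin y)) =
        fun _ => 0 := funext hC.2
    rw [h0] at h
    simpa [add_comm] using (DFunLike.congr_fun (h.unique (hasFDerivAt_const 0 x)) v)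
  have hsymm := second_derivative_symmetric
    (fun y => (hf.differentiable (by norm_num) y).hasFDerivAt) (hf' x).hasFDerivAt
    (A.toEuclideanLin x) (B.toEuclideanLin x)
  have h1 := key hA (B.toEuclideanLin x)
  have h2 := key hB (A.toEuclideanLin x)
  rw [map_sub, LinearMap.sub_apply, map_sub, toEuclideanLin_mul_apply, toEuclideanLin_mul_apply]
  linear_combination h1 - h2 + hsymm

theorem conj_mem_infinitesimalSymmetries {f : EuclideanSpace ℝ n → ℂ}
    {U A : Matrix n n ℝ} (hU : U * Uᵀ = 1) (hfU : ∀ x, f (U.toEuclideanLin x) = f x)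
    (hf : Differentiable ℝ f)
    (hA : A ∈ infinitesimalSymmetries f) : U * A * Uᵀ ∈ infinitesimalSymmetries f := by
  refine ⟨by simp [hA.1, mul_assoc], fun x => ?_⟩
  obtain ⟨y, rfl⟩ : ∃ y, U.toEuclideanLin y = x :=
    ⟨Uᵀ.toEuclideanLin x, by
      rw [← toEuclideanLin_mul_apply, hU]; simp⟩
  have h : HasFDerivAt f _ y := ((hf (U.toEuclideanLin y)).hasFDerivAt.comp y
    (LinearMap.toContinuousLinearMap U.toEuclideanLin).hasFDerivAt).congr_of_eventuallyEq
      (.of_forall fun z => (hfU z).symm)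
  have h1 := DFunLike.congr_fun (h.unique (hf y).hasFDerivAt) (A.toEuclideanLin y)
  rw [hA.2 y] at h1
  rw [← toEuclideanLin_mul_apply, mul_assoc, mul_eq_one_comm.1 hU, mul_one,
    toEuclideanLin_mul_apply]
  exact h1

theorem submatrix_mem_infinitesimalSymmetries {f : EuclideanSpace ℝ n → ℂ}
    (hf : Differentiable ℝ f) {σ : Equiv.Perm n}
    (hfσ : ∀ x, f ((σ.permMatrix ℝ).toEuclideanLin x) = f x) {A : Matrix n n ℝ}
    (hA : A ∈ infinitesimalSymmetries f) : A.submatrix σ σ ∈ infinitesimalSymmetries f := by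
  have h := conj_mem_infinitesimalSymmetries (U := σ.permMatrix ℝ)
    (by rw [Matrix.transpose_permMatrix, ← Matrix.permMatrix_mul]; simp) hfσ hf hA
  rw [Matrix.transpose_permMatrix, PEquiv.toMatrix_toPEquiv_mul, PEquiv.mul_toMatrix_toPEquiv]
    at h
  exact h

/-- For every `v` orthogonal to `p`, the vector `‖p‖ ^ 2 • v` is the image of `p` under the
skew-symmetric matrix of `v ∧ p`, so the derivative of `f` vanishes along spheres. In dimension at
least two these are connected. -/
theorem radial_of_infinitesimalSymmetries {f : EuclideanSpace ℝ n → ℂ} (hf : Differentiable ℝ f)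
    (hn : 1 < Fintype.card n)
    (h : ∀ A : Matrix n n ℝ, Aᵀ = -A → A ∈ infinitesimalSymmetries f)
    {x y : EuclideanSpace ℝ n} (hxy : ‖x‖ = ‖y‖) : f x = f y := by
  rcases eq_or_ne x 0 with rfl | hx
  · rw [norm_zero] at hxy
    rw [norm_eq_zero.1 hxy.symm]
  have hy : y ≠ 0 := norm_ne_zero_iff.1 (hxy ▸ norm_ne_zero_iff.2 hx)
  -- `p` is the radial projection onto the sphere through `x` and `y`
  set p : EuclideanSpace ℝ n → EuclideanSpace ℝ n := fun z => ‖x‖ • ‖z‖⁻¹ • z with hp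
  have hpnorm {z : EuclideanSpace ℝ n} (hz : z ≠ 0) : ‖p z‖ = ‖x‖ := by
    simp [hp, norm_smul, hz]
  have hpdiff {z : EuclideanSpace ℝ n} (hz : z ≠ 0) : DifferentiableAt ℝ p z :=
    (((differentiableAt_fun_id.norm ℝ hz).fun_inv (norm_ne_zero_iff.2 hz)).fun_smul
      differentiableAt_fun_id).fun_const_smul _
  have hconst : f (p x) = f (p y) := by
    refine isOpen_compl_singleton.is_const_of_fderiv_eq_zero (𝕜 := ℝ) (f := f ∘ p)
      (isConnected_compl_singleton_of_one_lt_rank (by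
        rw [← Module.finrank_eq_rank, finrank_euclideanSpace]; exact_mod_cast hn) 0).isPreconnected
      (fun z hz => ((hf _).comp z (hpdiff hz)).differentiableWithinAt) (fun z hz => ?_) hx hy
    have hpz : p z ≠ 0 := norm_ne_zero_iff.1 (by simpa [hpnorm hz] using hx)
    ext w
    rw [fderiv_comp z (hf _) (hpdiff hz)]
    set v := fderiv ℝ p z w with hv
    have hvz : ⟪p z, v⟫ = 0 := by
      have h1 := (hpdiff hz).hasFDerivAt.norm_sq
      have h2 : (fun z => ‖p z‖ ^ 2) =ᶠ[𝓝 z] fun _ => ‖x‖ ^ 2 := by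
        filter_upwards [isOpen_compl_singleton.mem_nhds hz] with z hz
        rw [hpnorm hz]
      have h3 := DFunLike.congr_fun (h1.unique ((hasFDerivAt_const _ z).congr_of_eventuallyEq h2)) w
      simpa using h3
    have hmem := (h _ (transpose_wedge v.ofLp (p z).ofLp)).2 (p z)
    have hwv : (wedge v.ofLp (p z).ofLp).toEuclideanLin (p z) = ‖p z‖ ^ 2 • v := by
      rw [← real_inner_self_eq_norm_sq]
      ext i
      simp only [EuclideanSpace.inner_eq_star_dotProduct, star_trivial] at hvz ⊢
      simp [Matrix.toLpLin_apply, wedge_mulVec, hvz]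
    rw [hwv, map_smul, smul_eq_zero] at hmem
    simpa [hv] using hmem.resolve_left (pow_ne_zero 2 (norm_ne_zero_iff.2 hpz))
  have hpx : p x = x := by simp [hp, smul_smul, hx]
  have hpy : p y = y := by simp [hp, smul_smul, hxy, hy]
  rwa [hpx, hpy] at hconst

open scoped Matrix.Norms.Elementwise in
/-- Consecutive terms `u k`, `u (k + 1)` of a convergent sequence of distinct elements of `S` have
quotients converging to `1`. -/
theorem exists_seq_tendsto_one {S : Set (Matrix n n ℝ)} (hS : S.Infinite)
    (hSO : ∀ U ∈ S, U * Uᵀ = 1) (hdiv : ∀ U ∈ S, ∀ V ∈ S, U * Vᵀ ∈ S) :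
    ∃ u : ℕ → Matrix n n ℝ, (∀ k, u k ∈ S ∧ u k ≠ 1) ∧ Tendsto u atTop (𝓝 1) := by
  have hinj := (Set.Infinite.natEmbedding S hS)
  have hbdd : Bornology.IsBounded S := by
    refine (Metric.isBounded_closedBall (x := (0 : Matrix n n ℝ)) (r := 1)).subset fun U hU => ?_
    rw [mem_closedBall_zero_iff, Matrix.norm_le_iff zero_le_one]
    exact entry_norm_bound_of_unitary (𝕜 := ℝ) (U := U) (by
      rw [Matrix.mem_unitaryGroup_iff]; exact hSO U hU)
  have : ProperSpace (Matrix n n ℝ) := FiniteDimensional.proper ℝ _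
  obtain ⟨P, -, φ, hφ, hP⟩ := tendsto_subseq_of_bounded hbdd (fun k => (hinj k).2)
  refine ⟨fun k => hinj (φ (k + 1)) * (hinj (φ k) : Matrix n n ℝ)ᵀ,
    fun k => ⟨hdiv _ (hinj _).2 _ (hinj _).2, fun hk => ?_⟩, ?_⟩
  · have h1 := hSO _ (hinj (φ k)).2
    have h2 : (hinj (φ (k + 1)) : Matrix n n ℝ) = hinj (φ k) := by
      calc (hinj (φ (k + 1)) : Matrix n n ℝ)
          = hinj (φ (k + 1)) * ((hinj (φ k) : Matrix n n ℝ)ᵀ * hinj (φ k)) := by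
            rw [mul_eq_one_comm.1 h1, mul_one]
        _ = hinj (φ k) := by rw [← mul_assoc, show _ * _ = _ from hk, one_mul]
    have := hφ.injective (hinj.injective (Subtype.ext h2))
    omega
  · have hcont : Continuous fun p : Matrix n n ℝ × Matrix n n ℝ => p.1 * p.2ᵀ :=
      continuous_fst.matrix_mul continuous_snd.matrix_transpose
    have hPP : P * Pᵀ = 1 :=
      tendsto_nhds_unique ((hcont.tendsto (P, P)).comp (hP.prodMk_nhds hP))
        (tendsto_const_nhds.congr fun k => (hSO _ (hinj (φ k)).2).symm)
    rw [← hPP]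
    exact (hcont.tendsto (P, P)).comp
      ((hP.comp (tendsto_add_atTop_nat 1)).prodMk_nhds hP)

open scoped Matrix.Norms.Elementwise in
/-- A limit point of the unit vectors `‖U - 1‖⁻¹ • (U - 1)`, as `U → 1` in `S`, is an infinitesimal
symmetry. -/
theorem exists_ne_zero_mem_infinitesimalSymmetries {f : EuclideanSpace ℝ n → ℂ}
    (hf : Differentiable ℝ f)
    {S : Set (Matrix n n ℝ)} (hS : S.Infinite)
    (hSO : ∀ U ∈ S, U * Uᵀ = 1) (hdiv : ∀ U ∈ S, ∀ V ∈ S, U * Vᵀ ∈ S)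
    (hfS : ∀ U ∈ S, ∀ x, f (U.toEuclideanLin x) = f x) :
    ∃ A ∈ infinitesimalSymmetries f, A ≠ 0 := by
  obtain ⟨u, hu, hu1⟩ := exists_seq_tendsto_one hS hSO hdiv
  have : ProperSpace (Matrix n n ℝ) := FiniteDimensional.proper ℝ _
  set D : ℕ → Matrix n n ℝ := fun k => u k - 1 with hD
  have hD0 (k : ℕ) : ‖D k‖ ≠ 0 := norm_ne_zero_iff.2 (sub_ne_zero.2 (hu k).2)
  have hDlim : Tendsto D atTop (𝓝 0) := by simpa [hD] using hu1.sub_const 1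
  obtain ⟨A, hA, φ, hφ, hlim⟩ := (isCompact_sphere (0 : Matrix n n ℝ) 1).tendsto_subseq
    (x := fun k => ‖D k‖⁻¹ • D k) (fun k => by
      rw [mem_sphere_zero_iff_norm, norm_smul, norm_inv, norm_norm, inv_mul_cancel₀ (hD0 k)])
  have hDφ := hDlim.comp hφ.tendsto_atTop
  refine ⟨A, ⟨?_, fun x => ?_⟩, ?_⟩
  · -- dividing `D + Dᵀ + D Dᵀ = 0` by `‖D‖` gives `A + Aᵀ = 0` in the limit
    have hcont : Continuous fun p : Matrix n n ℝ × Matrix n n ℝ => p.1 + p.1ᵀ + p.1 * p.2ᵀ :=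
      (continuous_fst.add continuous_fst.matrix_transpose).add
        (continuous_fst.matrix_mul continuous_snd.matrix_transpose)
    have h0 : A + Aᵀ + A * (0 : Matrix n n ℝ)ᵀ = 0 := by
      refine tendsto_nhds_unique ((hcont.tendsto (A, 0)).comp (hlim.prodMk_nhds hDφ))
        (tendsto_const_nhds.congr fun k => ?_)
      have h1 := hSO _ (hu (φ k)).1
      have h2 : u (φ k) = D (φ k) + 1 := by simp [hD]
      rw [h2, ← sub_eq_zero] at h1
      simp only [Function.comp, Matrix.transpose_smul, smul_mul_assoc, ← smul_add]
      rw [show D (φ k) + (D (φ k))ᵀ + D (φ k) * (D (φ k))ᵀ = 0 by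
        rw [← h1, Matrix.transpose_add, Matrix.transpose_one, mul_add, add_mul, one_mul, mul_one]
        abel, smul_zero]
    rw [Matrix.transpose_zero, mul_zero, add_zero] at h0
    exact eq_neg_of_add_eq_zero_right h0
  · have hev : Continuous fun B : Matrix n n ℝ => B.toEuclideanLin x :=
      LinearMap.continuous_of_finiteDimensional
        ((LinearMap.applyₗ x).comp (Matrix.toEuclideanLin (𝕜 := ℝ) (m := n) (n := n)).toLinearMap)
    refine tendsto_nhds_unique ((hf x).hasFDerivAt.hasFDerivWithinAt (s := Set.univ) |>.lim
      (l := atTop) (c := fun k => ‖D (φ k)‖⁻¹) (d := fun k => (D (φ k)).toEuclideanLin x)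
      (v := A.toEuclideanLin x)
      ?_ (by simp) ?_) (tendsto_const_nhds.congr fun k => ?_)
    · simpa [Function.comp_def] using (hev.tendsto 0).comp hDφ
    · simpa [Function.comp_def] using (hev.tendsto A).comp hlim
    · have h1 : x + (D (φ k)).toEuclideanLin x = (u (φ k)).toEuclideanLin x := by
        simp [hD, Matrix.toLpLin_apply]
      rw [h1, hfS _ (hu _).1, sub_self, smul_zero]
  · rintro rfl
    simp at hA

/-! ### Measures with radial characteristic function -/

theorem charFun_apply_of_map_eq_self {E : Type*} [NormedAddCommGroup E] [InnerProductSpace ℝ E]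
    [MeasurableSpace E] [BorelSpace E] [SecondCountableTopology E] {μ : Measure E} {T : E → E}
    (hT : Measurable T) (hinner : ∀ x y, ⟪T x, T y⟫ = ⟪x, y⟫) (hμ : μ.map T = μ) (ξ : E) :
    charFun μ (T ξ) = charFun μ ξ := by
  conv_lhs => rw [← hμ]
  rw [charFun_apply, charFun_apply, integral_map hT.aemeasurable (by fun_prop)]
  simp only [hinner]

/-- Since `charFun μ` is radial, its value at `ξ` is its average over `‖ξ‖ • y` with `y` distributed
as `ν`. By Fubini's theorem this average is symmetric in `μ` and `ν`. -/
theorem ext_of_radial_charFun {E : Type*} [NormedAddCommGroup E] [InnerProductSpace ℝ E]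
    [MeasurableSpace E] [BorelSpace E] [SecondCountableTopology E] [CompleteSpace E]
    {μ ν : Measure E} [IsProbabilityMeasure μ] [IsProbabilityMeasure ν]
    (hμ1 : ∀ᵐ x ∂μ, ‖x‖ = 1) (hν1 : ∀ᵐ x ∂ν, ‖x‖ = 1)
    (hμ : ∀ ξ η : E, ‖ξ‖ = ‖η‖ → charFun μ ξ = charFun μ η)
    (hν : ∀ ξ η : E, ‖ξ‖ = ‖η‖ → charFun ν ξ = charFun ν η) : μ = ν := by
  have key {μ ν : Measure E} [IsProbabilityMeasure ν] (hν1 : ∀ᵐ x ∂ν, ‖x‖ = 1)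
      (hμ : ∀ ξ η : E, ‖ξ‖ = ‖η‖ → charFun μ ξ = charFun μ η) (ξ : E) :
      charFun μ ξ = ∫ y, charFun μ (‖ξ‖ • y) ∂ν := by
    have h : ∀ᵐ y ∂ν, charFun μ (‖ξ‖ • y) = charFun μ ξ := by
      filter_upwards [hν1] with y hy
      exact hμ _ _ (by simp [norm_smul, hy])
    simp [integral_congr_ae h]
  refine Measure.ext_of_charFun (funext fun ξ => ?_)
  rw [key hν1 hμ ξ, key hμ1 hν ξ]
  simp only [charFun_apply]
  rw [integral_integral_swap]
  · simp only [real_inner_smul_right, real_inner_comm]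
  · refine Integrable.of_bound (by fun_prop) 1 (.of_forall fun p => ?_)
    simp only [Function.uncurry]
    rw [Complex.norm_exp_ofReal_mul_I]

theorem map_uniformSphere_eq_self {d : ℕ}
    (e : EuclideanSpace ℝ (Fin d) ≃ₗᵢ[ℝ] EuclideanSpace ℝ (Fin d)) :
    ((uniformSphere d).map Subtype.val).map e = (uniformSphere d).map Subtype.val := by
  ext s hs
  have hes : MeasurableSet (e ⁻¹' s) := e.continuous.measurable hs
  rw [Measure.map_apply e.continuous.measurable hs, Measure.map_apply measurable_subtype_coe hes,
    Measure.map_apply measurable_subtype_coe hs, uniformSphere, Measure.smul_apply,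
    Measure.smul_apply, Measure.toSphere_apply' _ (measurable_subtype_coe hes),
    Measure.toSphere_apply' _ (measurable_subtype_coe hs)]
  congr 2
  refine Eq.trans ?_ (MeasurePreserving.measure_preimage_equiv (f := e.toMeasurableEquiv)
    e.measurePreserving _)
  congr 1
  ext x
  simp only [Set.mem_smul, Set.mem_image, Set.mem_preimage,
    LinearIsometryEquiv.coe_toMeasurableEquiv]
  constructor
  · rintro ⟨r, hr, _, ⟨y, hy, rfl⟩, rfl⟩
    exact ⟨r, hr, e y, ⟨⟨e y, by simp⟩, hy, rfl⟩, by simp⟩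
  · rintro ⟨r, hr, _, ⟨y, hy, rfl⟩, hx⟩
    refine ⟨r, hr, e.symm y, ⟨⟨e.symm y, by simp⟩, by simpa using hy, rfl⟩, ?_⟩
    rw [← map_smul, hx, e.symm_apply_apply]

theorem charFun_map_uniformSphere_eq {d : ℕ} {ξ η : EuclideanSpace ℝ (Fin d)} (h : ‖ξ‖ = ‖η‖) :
    charFun ((uniformSphere d).map Subtype.val) ξ =
      charFun ((uniformSphere d).map Subtype.val) η := by
  -- `η` is the image of `ξ` under the reflection in the hyperplane orthogonal to `ξ - η`
  rw [← Submodule.reflection_sub h]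
  exact (charFun_apply_of_map_eq_self (LinearIsometryEquiv.continuous _).measurable
    (LinearIsometryEquiv.inner_map_map _) (map_uniformSphere_eq_self _) ξ).symm

theorem isProbabilityMeasure_uniformSphere {d : ℕ} (hd : d ≠ 0) :
    IsProbabilityMeasure (uniformSphere d) := by
  have : NeZero d := ⟨hd⟩
  refine ⟨?_⟩
  rw [uniformSphere, Measure.smul_apply, smul_eq_mul]
  exact ENNReal.inv_mul_cancel (Measure.measure_univ_ne_zero.2 (Measure.toSphere_ne_zero _))
    (measure_ne_top _ _)

/-! ### Infinite irreducible groups of rotations -/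

theorem coe_mul_transpose_of_specialOrthogonalGroup {n : Type*} [Fintype n] [DecidableEq n]
    (g : Matrix.specialOrthogonalGroup n ℝ) : (g : Matrix n n ℝ) * (g : Matrix n n ℝ)ᵀ = 1 :=
  (Matrix.mem_orthogonalGroup_iff n ℝ).1 (Matrix.mem_specialOrthogonalGroup_iff.1 g.2).1

/-- The common kernel of the infinitesimal symmetries is a subrepresentation. It is proper because
there is a nonzero infinitesimal symmetry, so by irreducibility it does not contain `1`. -/
theorem exists_mem_infinitesimalSymmetries_mulVec_one_ne_zero {d : ℕ}
    {H : Subgroup (Matrix.specialOrthogonalGroup (Fin d) ℝ)} (hirr : (standardRep H).IsIrreducible)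
    (hd : d ≠ 0) {f : EuclideanSpace ℝ (Fin d) → ℂ} (hf : Differentiable ℝ f)
    (hfH : ∀ (g : H) (x : EuclideanSpace ℝ (Fin d)), f (standardRep H g x) = f x)
    (hne : ∃ A ∈ infinitesimalSymmetries f, A ≠ 0) :
    ∃ A ∈ infinitesimalSymmetries f, A *ᵥ 1 ≠ 0 := by
  by_contra! hcon
  let W : Subrepresentation (standardRep H) :=
    { toSubmodule := ⨅ A ∈ infinitesimalSymmetries f, LinearMap.ker A.toEuclideanLin
      apply_mem_toSubmodule := fun g v hv => by
        simp only [Submodule.mem_iInf, LinearMap.mem_ker] at hv ⊢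
        intro A hA
        set U : Matrix (Fin d) (Fin d) ℝ := g.1.1
        have hUU : U * Uᵀ = 1 := coe_mul_transpose_of_specialOrthogonalGroup _
        have hfU (x : EuclideanSpace ℝ (Fin d)) : f (Uᵀ.toEuclideanLin x) = f x := by
          rw [← hfH g]
          change f (U.toEuclideanLin _) = _
          rw [← toEuclideanLin_mul_apply, hUU]
          simp
        have h1 := hv _ (conj_mem_infinitesimalSymmetries (U := Uᵀ)
          (by simpa using mul_eq_one_comm.1 hUU) hfU hf hA)
        change A.toEuclideanLin (U.toEuclideanLin v) = 0
        rw [Matrix.transpose_transpose] at h1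
        have h2 := congrArg U.toEuclideanLin h1
        rwa [← toEuclideanLin_mul_apply, ← mul_assoc, ← mul_assoc, hUU, one_mul, map_zero,
          toEuclideanLin_mul_apply] at h2 }
  rcases hirr.eq_bot_or_eq_top W with hW | hW
  · have h1 : (WithLp.toLp 2 1 : EuclideanSpace ℝ (Fin d)) ∈ W.toSubmodule := by
      simp only [W, Submodule.mem_iInf, LinearMap.mem_ker]
      intro A hA
      simp [Matrix.toLpLin_apply, hcon A hA]
    rw [hW] at h1
    have h2 : (WithLp.toLp 2 1 : EuclideanSpace ℝ (Fin d)) = 0 := h1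
    have h3 := congrArg (fun v : EuclideanSpace ℝ (Fin d) => v ⟨0, Nat.pos_of_ne_zero hd⟩) h2
    simp at h3
  · obtain ⟨A, hA, hA0⟩ := hne
    refine hA0 (Matrix.toEuclideanLin.injective (LinearMap.ext fun x => ?_))
    have h1 : x ∈ W.toSubmodule := by rw [hW]; exact Submodule.mem_top (x := x)
    simp only [W, Submodule.mem_iInf, LinearMap.mem_ker] at h1
    simpa using h1 A hA

/-- A `C^2` function that is invariant under permutations of the coordinates and under an infinite
irreducible group of rotations is radial. -/
theorem radial_of_invariant {d : ℕ} {H : Subgroup (Matrix.specialOrthogonalGroup (Fin d) ℝ)}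
    (hinf : Infinite H) (hirr : (standardRep H).IsIrreducible)
    {f : EuclideanSpace ℝ (Fin d) → ℂ} (hf : ContDiff ℝ 2 f)
    (hfH : ∀ (g : H) (x : EuclideanSpace ℝ (Fin d)), f (standardRep H g x) = f x)
    (hfperm : ∀ (σ : Equiv.Perm (Fin d)) (x : EuclideanSpace ℝ (Fin d)),
      f ((σ.permMatrix ℝ).toEuclideanLin x) = f x)
    {x y : EuclideanSpace ℝ (Fin d)} (hxy : ‖x‖ = ‖y‖) : f x = f y := by
  have hf1 : Differentiable ℝ f := hf.differentiable (by norm_num)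
  obtain ⟨A, hA, hA0⟩ : ∃ A ∈ infinitesimalSymmetries f, A ≠ 0 := by
    refine exists_ne_zero_mem_infinitesimalSymmetries hf1
      (S := Set.range fun g : H => ((g : Matrix.specialOrthogonalGroup (Fin d) ℝ) :
        Matrix (Fin d) (Fin d) ℝ))
      (Set.infinite_range_of_injective (Subtype.val_injective.comp Subtype.val_injective)) ?_ ?_ ?_
    · rintro _ ⟨g, rfl⟩
      exact coe_mul_transpose_of_specialOrthogonalGroup _
    · rintro _ ⟨g, rfl⟩ _ ⟨g', rfl⟩
      exact ⟨g * g'⁻¹, rfl⟩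
    · rintro _ ⟨g, rfl⟩ x
      exact hfH g x
  -- a nonzero skew-symmetric matrix has size at least two
  have hd : 1 < d := by
    by_contra! hd
    have : Subsingleton (Fin d) := Fin.subsingleton_iff_le_one.2 hd
    refine hA0 (Matrix.ext fun i j => ?_)
    have h1 : A i i = -A i i := congrFun₂ hA.1 i i
    rw [Subsingleton.elim j i, Matrix.zero_apply]
    linarith
  refine radial_of_infinitesimalSymmetries hf1 (by simpa using hd) (fun B hB => ?_) hxy
  exact mem_of_transpose_eq_neg _ (fun A hA => (mem_infinitesimalSymmetries.1 hA).1)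
    (fun A hA σ => submatrix_mem_infinitesimalSymmetries hf1 (hfperm σ) hA)
    (fun A hA B hB => mul_sub_mul_mem_infinitesimalSymmetries hf hA hB)
    (exists_mem_infinitesimalSymmetries_mulVec_one_ne_zero hirr (by omega) hf1 hfH ⟨A, hA, hA0⟩) hB

end

theorem mainTheorem5 {Ω : Type*} [MeasurableSpace Ω] (P : Measure Ω) [IsProbabilityMeasure P]
    (d : ℕ) (X : Ω → Metric.sphere (0 : EuclideanSpace ℝ (Fin d)) 1) (hX : AEMeasurable X P)
    (hexch : IsExchangeable (fun i ω => (X ω : EuclideanSpace ℝ (Fin d)) i) P)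
    (H : Subgroup (Matrix.specialOrthogonalGroup (Fin d) ℝ)) (hinf : Infinite H)
    (hirr : (standardRep H).IsIrreducible)
    (hinv : IsInvariantUnder H (P.map (fun ω => (X ω : EuclideanSpace ℝ (Fin d))))) :
    P.map X = uniformSphere d := by
  -- the unit sphere of a zero-dimensional space is empty
  have hd : d ≠ 0 := by
    rintro rfl
    obtain ⟨ω⟩ := P.nonempty_of_neZero
    have h1 := norm_eq_of_mem_sphere (X ω)
    rw [Subsingleton.elim (X ω : EuclideanSpace ℝ (Fin 0)) 0, norm_zero] at h1
    exact zero_ne_one h1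
  have := isProbabilityMeasure_uniformSphere hd
  have hXval : AEMeasurable (fun ω => (X ω : EuclideanSpace ℝ (Fin d))) P :=
    measurable_subtype_coe.comp_aemeasurable hX
  set μ := P.map (fun ω => (X ω : EuclideanSpace ℝ (Fin d))) with hμ
  have : IsProbabilityMeasure μ := Measure.isProbabilityMeasure_map hXval
  set ν := (uniformSphere d).map Subtype.val with hν
  have : IsProbabilityMeasure ν :=
    Measure.isProbabilityMeasure_map measurable_subtype_coe.aemeasurable
  have hμ1 : ∀ᵐ x ∂μ, ‖x‖ = 1 := by
    rw [hμ, ae_map_iff hXval (measurableSet_eq_fun measurable_norm measurable_const)]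
    exact .of_forall fun ω => norm_eq_of_mem_sphere (X ω)
  have hν1 : ∀ᵐ x ∂ν, ‖x‖ = 1 := by
    rw [hν, ae_map_iff measurable_subtype_coe.aemeasurable
      (measurableSet_eq_fun measurable_norm measurable_const)]
    exact .of_forall fun x => norm_eq_of_mem_sphere x
  have hsmooth : ContDiff ℝ 2 (charFun μ) := by
    refine contDiff_charFun (n := 2) (MemLp.of_bound (by fun_prop) 1 ?_)
    filter_upwards [hμ1] with x hx using hx.le
  have hH (g : H) (x : EuclideanSpace ℝ (Fin d)) :
      charFun μ (standardRep H g x) = charFun μ x := by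
    refine charFun_apply_of_map_eq_self
      (LinearMap.continuous_of_finiteDimensional _).measurable ?_ (hinv g) x
    exact inner_toEuclideanLin_toEuclideanLin
      (mul_eq_one_comm.1 (coe_mul_transpose_of_specialOrthogonalGroup _))
  have hperm (σ : Equiv.Perm (Fin d)) (x : EuclideanSpace ℝ (Fin d)) :
      charFun μ ((σ.permMatrix ℝ).toEuclideanLin x) = charFun μ x := by
    have hmeas : Measurable (σ.permMatrix ℝ).toEuclideanLin :=
      (LinearMap.continuous_of_finiteDimensional _).measurable
    refine charFun_apply_of_map_eq_self hmeas
      (inner_toEuclideanLin_toEuclideanLin (by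
        rw [Matrix.transpose_permMatrix, ← Matrix.permMatrix_mul]; simp)) ?_ x
    have h1 := (hexch σ).comp (u := WithLp.toLp 2) (by fun_prop)
    rw [hμ, AEMeasurable.map_map_of_aemeasurable hmeas.aemeasurable hXval]
    convert h1.map_eq using 2
    · ext ω i
      simp [Matrix.toLpLin_apply, Matrix.permMatrix_mulVec]
    · rfl
  have hμν : μ = ν := ext_of_radial_charFun hμ1 hν1
    (fun ξ η h => radial_of_invariant hinf hirr hsmooth hH hperm h)
    (fun ξ η h => charFun_map_uniformSphere_eq h)
  refine (MeasurableEmbedding.subtype_coe Metric.isClosed_sphere.measurableSet).map_injective ?_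
  rw [← hν, ← hμν, AEMeasurable.map_map_of_aemeasurable measurable_subtype_coe.aemeasurable hX]
  rfl
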